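/- For $N\in\mathbb N$, $N\ge 1$, and $f\colon\{-1,1\}^N\to\mathbb R$ let $\mathbb E[f]=2^{-N}\sum_{x\in\{-1,1\}^N}f(x)$ and $\|f\|_\infty=\max_x|f(x)|$, and for $S\subseteq\{1,\dots,N\}$ let $\widehat f(S)=\mathbb E\big[f(x)\prod_{k\in S}x_k\big]$ be the Fourier–Walsh coefficients of $f$. The Boolean radius of a class $\mathcal F$ of functions $\{-1,1\}^N\to\mathbb R$ is $$\rho(\mathcal F)=\sup\Big\{\rho\ge 0:\ \sum_{S\subseteq\{1,\dots,N\}}|\widehat f(S)|\,\rho^{|S|}\le\|f\|_\infty\ \text{ for every } f\in\mathcal F\Big\}.$$ For $0\le\delta\le1$ let $\mathcal B^N_\delta$ be the class of all $f\colon\{-1,1\}^N\to\mathbb R$ with $|\mathbb E[f]|\le(1-\delta)\|f\|_\infty$. **Theorem.** There is an absolute constant $C>0$ such that, for every integer $N\ge1$ and every real $\delta$ with $2^{-N}\le\delta\le1$, $$\frac{C^{-1}}{\sqrt N\,\sqrt{\log(2/\delta)}}\ \le\ \rho(\mathcal B^N_\delta)\ \le\ \frac{C}{\sqrt N\,\sqrt{\log(2/\delta)}}.$$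 -/

import Mathlib

/-- The Boolean cube `{-1, 1}^N`; `ℤˣ` is the two-element group `{1, -1}`. -/
abbrev BooleanCube (N : ℕ) : Type := Fin N → ℤˣ

/-- The Walsh function `χ_S(x) = x^S = ∏_{k ∈ S} x_k`, as a real-valued function. -/
def walsh {N : ℕ} (S : Finset (Fin N)) (x : BooleanCube N) : ℝ :=
  ∏ k ∈ S, (((x k : ℤˣ) : ℤ) : ℝ)

/-- The expectation `E[f] = 2^{-N} ∑_x f(x)` with respect to the uniform distribution. -/
noncomputable def expectation {N : ℕ} (f : BooleanCube N → ℝ) : ℝ :=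
  (1 / 2 ^ N) * ∑ x : BooleanCube N, f x

/-- The Fourier-Walsh coefficient of `f` at `S`, that is `E[f · χ_S]`. -/
noncomputable def fourierWalsh {N : ℕ} (f : BooleanCube N → ℝ) (S : Finset (Fin N)) : ℝ :=
  expectation (fun x => f x * walsh S x)

/-- The Boolean radius of a class `F` of functions on the Boolean cube: the supremum of all `ρ ≥ 0`
with `∑_S |f̂(S)| ρ^|S| ≤ ‖f‖_∞` for every `f ∈ F`.  The norm `‖f‖` on the functions on the finite
set `BooleanCube N` is the maximum norm. -/
noncomputable def booleanRadius {N : ℕ} (F : Set (BooleanCube N → ℝ)) : ℝ :=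
  sSup {ρ : ℝ | 0 ≤ ρ ∧
    ∀ f ∈ F, ∑ S : Finset (Fin N), |fourierWalsh f S| * ρ ^ S.card ≤ ‖f‖}

/-- The class of all real functions `f` on `{-1, 1}^N` with `|E[f]| ≤ (1 - δ) ‖f‖_∞`. -/
def biasedClass (N : ℕ) (δ : ℝ) : Set (BooleanCube N → ℝ) :=
  {f | |expectation f| ≤ (1 - δ) * ‖f‖}

/-! Lower bound. Replacing `f` by `-f` if needed, let `E f ≥ 0`, `M = ‖f‖` and `g = M - f`. Then `0
≤ g ≤ 2M`, `E g ≥ δM`, and apart from signs `f` and `g` have the same coefficients at nonempty `S`,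
so it suffices to bound the nonempty part of the sum by `E g = M - E f`. Since `g ≤ (2/δ) E g`,
hypercontractivity with exponent `2m`, `m ≈ log(2/δ)`, gives `∑ r^(2|S|) ĝ(S)² ≤ e (E g)²` for `r² =
1/(2m-1)` (`sum_pow_mul_sq_fourierWalsh_le`). Cauchy-Schwarz leaves the factor `(1 + ρ²/r²)^N - 1`,
which is small when `ρ² N log(2/δ)` is.

Upper bound. Keeping only degrees 0 and 1, an admissible `ρ` satisfies `|E f| + ρ E[f X] ≤ ‖f‖` with
`X = ∑ x_i`. For small `δ`, test the ±1-valued `f = 2·1_{X ≥ s} - 1`: if `P(X ≥ s) ≥ δ/2`, then `f`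
is in the class and `ρ s ≤ 1`. The tail bound `exp_le_expectation_upperTail` permits `s` of order
`√(N log(2/δ))`. For larger `δ` an odd test function with `s` of order `√N` suffices, and for small
`N` a single coordinate. -/

/-! ### Averages over the cube -/

section Expectation

variable {N : ℕ}

lemma expectation_add (f g : BooleanCube N → ℝ) :
    expectation (fun x => f x + g x) = expectation f + expectation g := by
  simp only [expectation, Finset.sum_add_distrib, mul_add]

lemma expectation_sub (f g : BooleanCube N → ℝ) :
    expectation (fun x => f x - g x) = expectation f - expectation g := by
  simp only [expectation, Finset.sum_sub_distrib, mul_sub]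

lemma expectation_const_mul (a : ℝ) (f : BooleanCube N → ℝ) :
    expectation (fun x => a * f x) = a * expectation f := by
  simp only [expectation, ← Finset.mul_sum]
  ring

lemma expectation_sum {ι : Type*} (s : Finset ι) (f : ι → BooleanCube N → ℝ) :
    expectation (fun x => ∑ i ∈ s, f i x) = ∑ i ∈ s, expectation (f i) := by
  simp only [expectation]
  rw [Finset.sum_comm, Finset.mul_sum]

lemma expectation_mono {f g : BooleanCube N → ℝ} (h : ∀ x, f x ≤ g x) :
    expectation f ≤ expectation g :=
  mul_le_mul_of_nonneg_left (Finset.sum_le_sum fun x _ => h x) (by positivity)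

lemma expectation_const (a : ℝ) : expectation (fun _ : BooleanCube N => a) = a := by
  simp [expectation, Finset.card_univ, Fintype.card_pi]

lemma expectation_nonneg {f : BooleanCube N → ℝ} (h : ∀ x, 0 ≤ f x) : 0 ≤ expectation f := by
  simpa [expectation_const] using expectation_mono (f := fun _ => 0) h

lemma expectation_translate (y : BooleanCube N) (f : BooleanCube N → ℝ) :
    expectation (fun x => f (y * x)) = expectation f := by
  simp only [expectation]
  congr 1
  exact Equiv.sum_comp (Equiv.mulLeft y) f

lemma expectation_neg_arg (f : BooleanCube N → ℝ) :
    expectation (fun x => f (-x)) = expectation f := by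
  simp only [expectation]
  congr 1
  exact Equiv.sum_comp (Equiv.neg (BooleanCube N)) f

/-- Jensen's inequality for powers, against the weight `g`. -/
lemma expectation_mul_pow_le (g h : BooleanCube N → ℝ) (hg : ∀ x, 0 ≤ g x) {n : ℕ}
    (hn : Even (n + 1)) :
    expectation (fun x => g x * h x) ^ (n + 1) ≤
      expectation g ^ n * expectation (fun x => g x * h x ^ (n + 1)) := by
  rcases (expectation_nonneg hg).eq_or_lt with h0 | h0
  · have hz : ∀ x, g x = 0 := by
      have : ∑ x, g x = 0 := by
        have := h0.symm
        simpa [expectation] using this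
      simpa using (Finset.sum_eq_zero_iff_of_nonneg (fun x _ => hg x)).1 this
    have e : expectation (fun _ : BooleanCube N => (0 : ℝ)) = 0 := expectation_const 0
    simp [hz, e]
  · have key := Real.pow_arith_mean_le_arith_mean_pow_of_even Finset.univ
      (fun x => g x * (1 / 2 ^ N) / expectation g) h
      (fun x _ => by have := hg x; positivity)
      (by
        rw [← Finset.sum_div, ← Finset.sum_mul, mul_comm]
        exact div_self h0.ne') hn
    have e : ∀ k : BooleanCube N → ℝ, ∑ x, g x * (1 / 2 ^ N) / expectation g * k x =
        expectation (fun x => g x * k x) / expectation g := by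
      intro k
      rw [eq_div_iff h0.ne', Finset.sum_mul,
        show expectation (fun x => g x * k x) = 1 / 2 ^ N * ∑ x, g x * k x from rfl, Finset.mul_sum]
      refine Finset.sum_congr rfl fun x _ => ?_
      field_simp
    rw [e h, e (fun x => h x ^ (n + 1)), div_pow, div_le_iff₀ (by positivity)] at key
    calc _ ≤ _ := key
      _ = _ := by
        field_simp
        ring

/-- The Cauchy-Schwarz inequality. -/
lemma expectation_mul_sq_le (f g : BooleanCube N → ℝ) :
    expectation (fun x => f x * g x) ^ 2 ≤
      expectation (fun x => f x ^ 2) * expectation (fun x => g x ^ 2) := by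
  simp only [expectation]
  have := Finset.sum_mul_sq_le_sq_mul_sq Finset.univ f g
  calc _ = (1 / 2 ^ N) ^ 2 * (∑ x, f x * g x) ^ 2 := by ring
    _ ≤ (1 / 2 ^ N) ^ 2 * ((∑ x, f x ^ 2) * ∑ x, g x ^ 2) := by gcongr
    _ = _ := by ring

end Expectation

/-! ### Walsh functions -/

section Walsh

variable {N : ℕ}

lemma walsh_mul (S : Finset (Fin N)) (x y : BooleanCube N) :
    walsh S (x * y) = walsh S x * walsh S y := by
  simp [walsh, Finset.prod_mul_distrib]

lemma walsh_singleton (i : Fin N) (x : BooleanCube N) :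
    walsh {i} x = (((x i : ℤˣ) : ℤ) : ℝ) := by
  simp [walsh]

lemma walsh_insert {S : Finset (Fin N)} {a : Fin N} (h : a ∉ S) (x : BooleanCube N) :
    walsh (insert a S) x = walsh {a} x * walsh S x := by
  simp [walsh, Finset.prod_insert h]

lemma walsh_singleton_sq (i : Fin N) (x : BooleanCube N) : walsh {i} x ^ 2 = 1 := by
  rw [walsh_singleton]
  rcases Int.units_eq_one_or (x i) with h | h <;> simp [h]

lemma walsh_singleton_neg (i : Fin N) (x : BooleanCube N) : walsh {i} (-x) = -walsh {i} x := by
  simp [walsh_singleton]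

lemma walsh_mulSingle_of_mem {S : Finset (Fin N)} {a : Fin N} (h : a ∈ S) :
    walsh S (Pi.mulSingle a (-1)) = -1 := by
  rw [walsh, Finset.prod_eq_single_of_mem a h]
  · simp
  · intro b _ hb
    simp [Pi.mulSingle_eq_of_ne hb]

lemma walsh_mulSingle_of_notMem {S : Finset (Fin N)} {a : Fin N} (h : a ∉ S) :
    walsh S (Pi.mulSingle a (-1)) = 1 := by
  refine Finset.prod_eq_one fun b hb => ?_
  have : b ≠ a := fun e => h (e ▸ hb)
  simp [Pi.mulSingle_eq_of_ne this]

lemma expectation_walsh_of_nonempty {S : Finset (Fin N)} (hS : S.Nonempty) :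
    expectation (walsh S) = 0 := by
  obtain ⟨a, ha⟩ := hS
  have h := expectation_translate (Pi.mulSingle a (-1)) (walsh S)
  simp only [walsh_mul, walsh_mulSingle_of_mem ha, expectation_const_mul] at h
  linarith

lemma fourierWalsh_empty (f : BooleanCube N → ℝ) : fourierWalsh f ∅ = expectation f := by
  simp [fourierWalsh, walsh]

end Walsh

/-! ### Hypercontractivity and the level inequality -/

section Hypercontractivity

variable {N : ℕ}

/-- With `m = k + 1 + j`, passing from `k` to `k + 1` multiplies the left binomial by the same ratio
as the right one, times `(2j+1)/(2k+1) ≤ 2m - 1`. -/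
lemma choose_two_mul_le (m k : ℕ) (hk : k ≤ m) :
    ((2 * m).choose (2 * k) : ℝ) ≤ (2 * m - 1) ^ k * m.choose k := by
  induction k with
  | zero => simp
  | succ k ih =>
    have ih := ih (by omega)
    have h1 := Nat.choose_succ_right_eq (2 * m) (2 * k)
    have h2 := Nat.choose_succ_right_eq (2 * m) (2 * k + 1)
    have h3 := Nat.choose_succ_right_eq m k
    obtain ⟨j, rfl⟩ := Nat.exists_eq_add_of_le hk
    rw [show 2 * (k + 1 + j) - 2 * k = 2 * j + 2 by omega] at h1
    rw [show 2 * (k + 1 + j) - (2 * k + 1) = 2 * j + 1 by omega] at h2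
    rw [show k + 1 + j - k = j + 1 by omega] at h3
    rw [show 2 * k + 1 + 1 = 2 * (k + 1) by omega] at h2
    have h1' : ((2 * (k + 1 + j)).choose (2 * k + 1) : ℝ) * (2 * k + 1) =
      (2 * (k + 1 + j)).choose (2 * k) * (2 * j + 2) := by exact_mod_cast h1
    have h2' : ((2 * (k + 1 + j)).choose (2 * (k + 1)) : ℝ) * (2 * (k + 1)) =
      (2 * (k + 1 + j)).choose (2 * k + 1) * (2 * j + 1) := by exact_mod_cast h2
    have h3' : ((k + 1 + j).choose (k + 1) : ℝ) * (k + 1) =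
      (k + 1 + j).choose k * (j + 1) := by exact_mod_cast h3
    have e1 : ((2 * (k + 1 + j)).choose (2 * (k + 1)) : ℝ) =
        (2 * (k + 1 + j)).choose (2 * k) * ((j + 1) / (k + 1)) * ((2 * j + 1) / (2 * k + 1)) := by
      field_simp
      linear_combination (2 * k + 1 : ℝ) * h2' / 2 + (2 * j + 1 : ℝ) * h1' / 2
    have e2 : ((k + 1 + j).choose (k + 1) : ℝ) =
        (k + 1 + j).choose k * ((j + 1) / (k + 1)) := by
      field_simp
      linear_combination h3'
    rw [e1, e2]
    push_cast at ih ⊢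
    have hb : ((2 * j + 1) / (2 * k + 1) : ℝ) ≤ 2 * (k + 1 + j) - 1 := by
      rw [div_le_iff₀ (by positivity)]
      have : (0 : ℝ) ≤ k := by positivity
      have : (0 : ℝ) ≤ j := by positivity
      nlinarith [mul_nonneg ‹(0 : ℝ) ≤ k› ‹(0 : ℝ) ≤ j›]
    have hn : (0 : ℝ) ≤ 2 * (k + 1 + j) - 1 := le_trans (by positivity) hb
    calc _ ≤ ((2 * (k + 1 + j) - 1 : ℝ) ^ k * (k + 1 + j).choose k) * ((j + 1) / (k + 1)) *
          (2 * (k + 1 + j) - 1) := by gcongr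
      _ = _ := by ring

lemma sum_range_two_mul_add_one_of_odd_eq_zero (g : ℕ → ℝ) (hg : ∀ k, g (2 * k + 1) = 0) (m : ℕ) :
    ∑ j ∈ Finset.range (2 * m + 1), g j = ∑ k ∈ Finset.range (m + 1), g (2 * k) := by
  induction m with
  | zero => simp
  | succ m ih =>
    rw [show 2 * (m + 1) + 1 = 2 * m + 1 + 1 + 1 by ring, Finset.sum_range_succ,
      Finset.sum_range_succ, ih, Finset.sum_range_succ _ (m + 1), hg]
    ring_nf

/-- The two-point hypercontractive inequality from `L²` to `L^{2m}`. -/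
lemma two_point_hypercontractive {m : ℕ} {r : ℝ} (hr : (2 * m - 1) * r ^ 2 ≤ 1) (a b : ℝ) :
    ((a + r * b) ^ (2 * m) + (a - r * b) ^ (2 * m)) / 2 ≤ (a ^ 2 + b ^ 2) ^ m := by
  have e : (a + r * b) ^ (2 * m) + (a - r * b) ^ (2 * m) =
      ∑ j ∈ Finset.range (2 * m + 1),
        ((r * b) ^ j + (-(r * b)) ^ j) * a ^ (2 * m - j) * ((2 * m).choose j : ℝ) := by
    rw [show a + r * b = r * b + a by ring, show a - r * b = -(r * b) + a by ring, add_pow, add_pow,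
      ← Finset.sum_add_distrib]
    exact Finset.sum_congr rfl fun j _ => by ring
  -- Odd powers of `b` cancel; the even ones are compared term by term with the binomial expansion
  -- on the right.
  rw [e, sum_range_two_mul_add_one_of_odd_eq_zero _ (fun k => by
    rw [Odd.neg_pow ⟨k, rfl⟩]; ring), add_comm (a ^ 2), add_pow, Finset.sum_div]
  refine Finset.sum_le_sum fun k hk => ?_
  have hk : k ≤ m := by simpa [Nat.lt_succ_iff] using hk
  have hc : (r ^ 2) ^ k * ((2 * m).choose (2 * k) : ℝ) ≤ m.choose k := by
    rcases Nat.eq_zero_or_pos m with rfl | hm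
    · obtain rfl : k = 0 := by omega
      simp
    have hm' : (1 : ℝ) ≤ m := by exact_mod_cast hm
    calc _ ≤ (r ^ 2) ^ k * ((2 * m - 1) ^ k * m.choose k) := by
          gcongr
          exact choose_two_mul_le m k hk
      _ = ((2 * m - 1) * r ^ 2) ^ k * m.choose k := by rw [mul_pow]; ring
      _ ≤ 1 * m.choose k := by
          gcongr
          exact pow_le_one₀ (mul_nonneg (by linarith) (sq_nonneg r)) hr
      _ = _ := one_mul _
  have e1 : a ^ (2 * m - 2 * k) = (a ^ 2) ^ (m - k) := by
    rw [← pow_mul, Nat.mul_sub]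
  rw [e1, Even.neg_pow ⟨k, by ring⟩]
  calc _ = (b ^ 2) ^ k * (a ^ 2) ^ (m - k) * ((r ^ 2) ^ k * ((2 * m).choose (2 * k) : ℝ)) := by ring
    _ ≤ _ := by gcongr

/-- Minkowski's inequality in `L^m` for nonnegative functions. -/
lemma expectation_add_pow_le {u v : BooleanCube N → ℝ} (hu : ∀ x, 0 ≤ u x) (hv : ∀ x, 0 ≤ v x)
    {α β : ℝ} (hα : 0 < α) (hβ : 0 < β) {m : ℕ} (h1 : expectation (fun x => u x ^ m) ≤ α ^ m)
    (h2 : expectation (fun x => v x ^ m) ≤ β ^ m) :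
    expectation (fun x => (u x + v x) ^ m) ≤ (α + β) ^ m := by
  -- Convexity of `t ^ m` at `u/α` and `v/β`, with weights `α/(α+β)` and `β/(α+β)`.
  have hp : ∀ x, (u x + v x) ^ m ≤
      (α + β) ^ m * (α / (α + β) * (1 / α ^ m)) * u x ^ m +
        (α + β) ^ m * (β / (α + β) * (1 / β ^ m)) * v x ^ m := by
    intro x
    have ha : 0 ≤ α / (α + β) := by positivity
    have hb : 0 ≤ β / (α + β) := by positivity
    have := (convexOn_pow m).2 (div_nonneg (hu x) hα.le) (div_nonneg (hv x) hβ.le) ha hb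
      (by field_simp)
    simp only [smul_eq_mul] at this
    calc (u x + v x) ^ m
        = (α + β) ^ m * (α / (α + β) * (u x / α) + β / (α + β) * (v x / β)) ^ m := by
          rw [← mul_pow]; congr 1; field_simp
      _ ≤ (α + β) ^ m * (α / (α + β) * (u x / α) ^ m + β / (α + β) * (v x / β) ^ m) := by gcongr
      _ = _ := by rw [div_pow, div_pow]; ring
  refine (expectation_mono hp).trans ?_
  rw [expectation_add, expectation_const_mul, expectation_const_mul]
  calc _ ≤ (α + β) ^ m * (α / (α + β) * (1 / α ^ m)) * α ^ m +
        (α + β) ^ m * (β / (α + β) * (1 / β ^ m)) * β ^ m := by gcongr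
    _ = _ := by field_simp

/-- Hypercontractivity of the noise operator from `L²` to `L^{2m}`, for Walsh polynomials with
frequencies in `A`. -/
theorem hypercontractive_powerset {m : ℕ} {r : ℝ} (hr : (2 * m - 1) * r ^ 2 ≤ 1)
    (A : Finset (Fin N)) (c : Finset (Fin N) → ℝ) :
    expectation (fun x => (∑ S ∈ A.powerset, r ^ S.card * c S * walsh S x) ^ (2 * m)) ≤
      (∑ S ∈ A.powerset, c S ^ 2) ^ m := by
  induction A using Finset.induction_on generalizing c with
  | empty => simp [walsh, expectation_const, pow_mul]
  | insert a A ha ih =>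
    set G : BooleanCube N → ℝ := fun x => ∑ S ∈ A.powerset, r ^ S.card * c S * walsh S x with hG
    set H : BooleanCube N → ℝ :=
      fun x => ∑ S ∈ A.powerset, r ^ S.card * c (insert a S) * walsh S x with hH
    have hmem : ∀ S ∈ A.powerset, a ∉ S := fun S hS h => ha (Finset.mem_powerset.1 hS h)
    have hsplit : ∀ x, ∑ S ∈ (insert a A).powerset, r ^ S.card * c S * walsh S x =
        G x + r * (walsh {a} x * H x) := by
      intro x
      rw [Finset.sum_powerset_insert ha]
      congr 1
      rw [hH, Finset.mul_sum, Finset.mul_sum]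
      refine Finset.sum_congr rfl fun S hS => ?_
      rw [walsh_insert (hmem S hS), Finset.card_insert_of_notMem (hmem S hS)]
      ring
    have hinv : ∀ (d : Finset (Fin N) → ℝ) x,
        ∑ S ∈ A.powerset, d S * walsh S (Pi.mulSingle a (-1) * x) =
          ∑ S ∈ A.powerset, d S * walsh S x := fun d x =>
      Finset.sum_congr rfl fun S hS => by
        rw [walsh_mul, walsh_mulSingle_of_notMem (hmem S hS), one_mul]
    have hsq : ∀ x, (walsh {a} x * H x) ^ 2 = H x ^ 2 := fun x => by
      rw [mul_pow, walsh_singleton_sq, one_mul]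
    -- Flipping `x_a` fixes `G` and `H` and changes the sign of `walsh {a}`; averaging over the flip
    -- reduces to the two-point inequality.
    have hle : expectation (fun x => (G x + r * (walsh {a} x * H x)) ^ (2 * m)) ≤
        expectation (fun x => (G x ^ 2 + H x ^ 2) ^ m) := by
      have h1 := expectation_translate (Pi.mulSingle a (-1))
        (fun x => (G x + r * (walsh {a} x * H x)) ^ (2 * m))
      have h2 : ∀ x, (G (Pi.mulSingle a (-1) * x) + r * (walsh {a} (Pi.mulSingle a (-1) * x) *
          H (Pi.mulSingle a (-1) * x))) ^ (2 * m) = (G x - r * (walsh {a} x * H x)) ^ (2 * m) := by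
        intro x
        rw [show G (Pi.mulSingle a (-1) * x) = G x from hinv _ x,
          show H (Pi.mulSingle a (-1) * x) = H x from hinv _ x, walsh_mul,
          walsh_mulSingle_of_mem (Finset.mem_singleton_self a)]
        ring
      simp only [h2] at h1
      have h3 := expectation_mono (N := N) fun x => two_point_hypercontractive hr (G x)
        (walsh {a} x * H x)
      simp only [hsq, div_eq_inv_mul, expectation_const_mul, expectation_add, h1] at h3
      linarith
    simp only [hsplit]
    refine hle.trans ?_
    rw [Finset.sum_powerset_insert ha]
    have ihG := ih c
    have ihH := ih fun S => c (insert a S)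
    have hzero : ∀ d : Finset (Fin N) → ℝ, ∑ S ∈ A.powerset, d S ^ 2 = 0 → ∀ x,
        ∑ S ∈ A.powerset, r ^ S.card * d S * walsh S x = 0 := fun d h x =>
      Finset.sum_eq_zero fun S hS => by
        have := (Finset.sum_eq_zero_iff_of_nonneg fun S _ => sq_nonneg (d S)).1 h S hS
        rw [pow_eq_zero_iff two_ne_zero] at this
        simp [this]
    -- The Minkowski step needs both bounds positive, so a vanishing `G` or `H` is treated apart.
    rcases (Finset.sum_nonneg fun S (_ : S ∈ A.powerset) => sq_nonneg (c S)).eq_or_lt with h0 | h0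
    · have : ∀ x, G x = 0 := hzero c h0.symm
      simp only [this, ← h0, zero_add, ne_eq, OfNat.ofNat_ne_zero, not_false_eq_true, zero_pow,
        ← pow_mul]
      exact ihH
    rcases (Finset.sum_nonneg fun S (_ : S ∈ A.powerset) =>
      sq_nonneg (c (insert a S))).eq_or_lt with h1 | h1
    · have : ∀ x, H x = 0 := hzero (fun S => c (insert a S)) h1.symm
      simp only [this, ← h1, add_zero, ne_eq, OfNat.ofNat_ne_zero, not_false_eq_true, zero_pow,
        ← pow_mul]
      exact ihG
    refine expectation_add_pow_le (fun x => sq_nonneg _) (fun x => sq_nonneg _) h0 h1 ?_ ?_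
    · simpa only [← pow_mul] using ihG
    · simpa only [← pow_mul] using ihH

/-- Level inequality: a nonnegative function bounded by `e^m` times its mean has a small noisy
Fourier weight. -/
theorem sum_pow_mul_sq_fourierWalsh_le {m : ℕ} (hm : m ≠ 0) {r : ℝ}
    (hr : (2 * m - 1) * r ^ 2 ≤ 1) {g : BooleanCube N → ℝ} {B : ℝ} (hg : ∀ x, 0 ≤ g x)
    (hB : ∀ x, g x ≤ B) (hBm : B ≤ Real.exp m * expectation g) :
    ∑ S : Finset (Fin N), (r ^ S.card * fourierWalsh g S) ^ 2 ≤
      Real.exp 1 * expectation g ^ 2 := by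
  set c : Finset (Fin N) → ℝ := fun S => r ^ S.card * fourierWalsh g S with hc
  set W := ∑ S : Finset (Fin N), c S ^ 2 with hW
  have hW0 : 0 ≤ W := Finset.sum_nonneg fun S _ => sq_nonneg _
  set H : BooleanCube N → ℝ := fun x => ∑ S : Finset (Fin N), r ^ S.card * c S * walsh S x
  have hμ := expectation_nonneg hg
  set μ := expectation g
  -- `H` is the noise operator applied twice to `g`, so duality turns the weight `W` into a pairing
  -- with `g`.
  have e : expectation (fun x => g x * H x) = W := by
    simp only [H, Finset.mul_sum]
    rw [expectation_sum]
    refine Finset.sum_congr rfl fun S _ => ?_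
    have : (fun x => g x * (r ^ S.card * c S * walsh S x)) =
        fun x => (r ^ S.card * c S) * (g x * walsh S x) := by
      funext x; ring
    rw [this, expectation_const_mul, ← fourierWalsh]
    simp only [hc]
    ring
  have hyp := hypercontractive_powerset hr Finset.univ c
  simp only [Finset.powerset_univ] at hyp
  obtain ⟨n, hn⟩ : ∃ n, 2 * m = n + 1 := ⟨2 * m - 1, by omega⟩
  have hj := expectation_mul_pow_le g H hg (n := n) ⟨m, by omega⟩
  rw [e, ← hn] at hj
  have hB0 : 0 ≤ B := (hg 1).trans (hB 1)
  have h1 : expectation (fun x => g x * H x ^ (2 * m)) ≤ B * W ^ m := by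
    calc _ ≤ expectation (fun x => B * H x ^ (2 * m)) := expectation_mono fun x =>
          mul_le_mul_of_nonneg_right (hB x) (Even.pow_nonneg ⟨m, by ring⟩ _)
      _ ≤ _ := by rw [expectation_const_mul]; gcongr
  -- Jensen against the weight `g`, then `g ≤ B` and hypercontractivity for `H`; cancelling `W ^ m`
  -- gives the claim.
  have h2 : W ^ m * W ^ m ≤ (Real.exp 1 * μ ^ 2) ^ m * W ^ m := by
    calc W ^ m * W ^ m = W ^ (2 * m) := by ring
      _ ≤ μ ^ n * (B * W ^ m) := hj.trans (by gcongr)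
      _ ≤ μ ^ n * ((Real.exp m * μ) * W ^ m) := by gcongr
      _ = Real.exp m * μ ^ (n + 1) * W ^ m := by ring
      _ = _ := by rw [← hn, mul_pow, ← Real.exp_nat_mul, ← pow_mul, mul_one]
  rcases hW0.eq_or_lt with h0 | h0
  · rw [← h0]; positivity
  · exact le_of_pow_le_pow_left₀ hm (by positivity) (le_of_mul_le_mul_right h2 (by positivity))

end Hypercontractivity

/-! ### Lower bound for the radius -/

section LowerBound

variable {N : ℕ}

lemma sum_sq_pow_card_erase_empty (q : ℝ) :
    ∑ S ∈ (Finset.univ : Finset (Finset (Fin N))).erase ∅, (q ^ S.card) ^ 2 =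
      (1 + q ^ 2) ^ N - 1 := by
  have h := Finset.sum_pow_mul_eq_add_pow (q ^ 2) 1 (Finset.univ : Finset (Fin N))
  simp only [one_pow, mul_one, Finset.powerset_univ, Finset.card_univ, Fintype.card_fin] at h
  rw [Finset.sum_erase_eq_sub (Finset.mem_univ _), add_comm 1, ← h]
  simp [← pow_mul, mul_comm]

lemma half_le_log_two_div {δ : ℝ} (h0 : 0 < δ) (h1 : δ ≤ 1) : 1 / 2 ≤ Real.log (2 / δ) := by
  have : Real.log 2 ≤ Real.log (2 / δ) := by
    apply Real.log_le_log two_pos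
    rw [le_div_iff₀ h0]
    linarith
  linarith [Real.log_two_gt_d9]

lemma abs_fourierWalsh_const_sub {f : BooleanCube N → ℝ} (M : ℝ) {S : Finset (Fin N)}
    (hS : S.Nonempty) : |fourierWalsh (fun x => M - f x) S| = |fourierWalsh f S| := by
  have : fourierWalsh (fun x => M - f x) S = -fourierWalsh f S := by
    simp only [fourierWalsh, sub_mul]
    rw [expectation_sub, expectation_const_mul, expectation_walsh_of_nonempty hS]
    ring
  rw [this, abs_neg]

lemma sum_abs_fourierWalsh_le_of_expectation_nonneg {δ ρ : ℝ} (h0 : 0 < δ)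
    (h1 : δ ≤ 1) (hρ : 16 * (ρ ^ 2 * N * Real.log (2 / δ)) ≤ 1)
    {f : BooleanCube N → ℝ} (hf0 : 0 ≤ expectation f) (hf : expectation f ≤ (1 - δ) * ‖f‖) :
    ∑ S : Finset (Fin N), |fourierWalsh f S| * ρ ^ S.card ≤ ‖f‖ := by
  have hL := half_le_log_two_div h0 h1
  set L := Real.log (2 / δ) with hLdef
  set m := ⌈L⌉₊ with hmdef
  have hmL : L ≤ m := Nat.le_ceil L
  have hmL' : (m : ℝ) < L + 1 := Nat.ceil_lt_add_one (by linarith)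
  have hm : m ≠ 0 := fun h => by
    rw [h] at hmL
    norm_num at hmL
    linarith
  have hm1 : (1 : ℝ) ≤ m := by exact_mod_cast Nat.one_le_iff_ne_zero.2 hm
  set M := ‖f‖
  have hM : 0 ≤ M := norm_nonneg f
  have habs : ∀ x, |f x| ≤ M := fun x => norm_le_pi_norm f x
  set g : BooleanCube N → ℝ := fun x => M - f x with hg
  have hEg : expectation g = M - expectation f := by
    rw [hg, expectation_sub, expectation_const]
  have hgB : 2 * M ≤ Real.exp m * expectation g := by
    have hexp : 2 / δ ≤ Real.exp m := by
      rw [← Real.exp_log (show 0 < 2 / δ by positivity)]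
      exact Real.exp_le_exp.2 hmL
    calc 2 * M = 2 / δ * (δ * M) := by field_simp
      _ ≤ Real.exp m * expectation g := by
        gcongr
        rw [hEg]
        linarith
  have hr0 : (0 : ℝ) < 2 * m - 1 := by linarith
  set r : ℝ := (√(2 * m - 1))⁻¹ with hr
  have hrpos : 0 < r := by positivity
  have hr2 : r ^ 2 = (2 * (m : ℝ) - 1)⁻¹ := by rw [hr, inv_pow, Real.sq_sqrt hr0.le]
  have hW := sum_pow_mul_sq_fourierWalsh_le (g := g) (B := 2 * M) (r := r) hm
    (by rw [hr2, mul_inv_cancel₀ hr0.ne'])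
    (fun x => by linarith [(abs_le.1 (habs x)).2]) (fun x => by linarith [(abs_le.1 (habs x)).1]) hgB
  have hEg0 : 0 ≤ expectation g := by
    rw [hEg]
    nlinarith
  -- The value `1/3` suffices because `e / 3 < 1`. Here `L ≥ 1/2` gives `2m - 1 ≤ 2L + 1 ≤ 4L`,
  -- which accounts for the constant 16.
  have hgeom : (1 + (ρ / r) ^ 2) ^ N - 1 ≤ 1 / 3 := by
    have hq : (ρ / r) ^ 2 * N ≤ 1 / 4 := by
      rw [div_pow, hr2, div_inv_eq_mul]
      calc ρ ^ 2 * (2 * m - 1) * N ≤ ρ ^ 2 * (4 * L) * N := by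
            gcongr
            linarith
        _ ≤ 1 / 4 := by linarith
    have hexp : Real.exp (1 / 4) ≤ 4 / 3 := by
      have h := Real.add_one_le_exp (-(1 / 4) : ℝ)
      rw [Real.exp_neg] at h
      have hp := Real.exp_pos (1 / 4)
      have h2 := mul_le_mul_of_nonneg_right h hp.le
      rw [inv_mul_cancel₀ hp.ne'] at h2
      linarith
    have : (1 + (ρ / r) ^ 2) ^ N ≤ Real.exp (1 / 4) := by
      calc (1 + (ρ / r) ^ 2) ^ N ≤ Real.exp ((ρ / r) ^ 2) ^ N := by
            gcongr
            rw [add_comm]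
            exact Real.add_one_le_exp _
        _ = Real.exp ((ρ / r) ^ 2 * N) := by rw [← Real.exp_nat_mul, mul_comm]
        _ ≤ _ := Real.exp_le_exp.2 hq
    linarith
  have htail : ∑ S ∈ (Finset.univ : Finset (Finset (Fin N))).erase ∅,
      |fourierWalsh f S| * ρ ^ S.card ≤ expectation g := by
    refine abs_le_of_sq_le_sq' ?_ hEg0 |>.2
    calc _ = (∑ S ∈ (Finset.univ : Finset (Finset (Fin N))).erase ∅,
          |r ^ S.card * fourierWalsh g S| * (ρ / r) ^ S.card) ^ 2 := by
          congr 1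
          refine Finset.sum_congr rfl fun S hS => ?_
          rw [abs_mul, hg, abs_fourierWalsh_const_sub M
            (Finset.nonempty_iff_ne_empty.2 (Finset.ne_of_mem_erase hS)),
            abs_of_pos (show 0 < r ^ S.card by positivity),
            div_pow]
          field_simp
      _ ≤ (∑ S ∈ (Finset.univ : Finset (Finset (Fin N))).erase ∅,
            |r ^ S.card * fourierWalsh g S| ^ 2) *
          ∑ S ∈ (Finset.univ : Finset (Finset (Fin N))).erase ∅, ((ρ / r) ^ S.card) ^ 2 :=
          Finset.sum_mul_sq_le_sq_mul_sq _ _ _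
      _ ≤ (Real.exp 1 * expectation g ^ 2) * (1 / 3) := by
          rw [sum_sq_pow_card_erase_empty]
          have hsub : ∑ S ∈ (Finset.univ : Finset (Finset (Fin N))).erase ∅,
              |r ^ S.card * fourierWalsh g S| ^ 2 ≤ Real.exp 1 * expectation g ^ 2 := by
            simp only [sq_abs]
            exact (Finset.sum_le_sum_of_subset_of_nonneg (Finset.erase_subset _ _)
              fun _ _ _ => sq_nonneg _).trans hW
          exact mul_le_mul hsub hgeom (by
            rw [sub_nonneg]
            exact one_le_pow₀ (by linarith [sq_nonneg (ρ / r)])) (by positivity)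
      _ ≤ expectation g ^ 2 := by
          nlinarith [Real.exp_one_lt_d9, sq_nonneg (expectation g)]
  rw [← Finset.add_sum_erase _ _ (Finset.mem_univ ∅), fourierWalsh_empty, abs_of_nonneg hf0]
  rw [hEg] at htail
  simp only [Finset.card_empty, pow_zero, mul_one]
  linarith

theorem sum_abs_fourierWalsh_le_norm {δ ρ : ℝ} (h0 : 0 < δ) (h1 : δ ≤ 1)
    (hρ : 16 * (ρ ^ 2 * N * Real.log (2 / δ)) ≤ 1)
    {f : BooleanCube N → ℝ} (hf : f ∈ biasedClass N δ) :
    ∑ S : Finset (Fin N), |fourierWalsh f S| * ρ ^ S.card ≤ ‖f‖ := by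
  have hf : |expectation f| ≤ (1 - δ) * ‖f‖ := hf
  rcases le_total 0 (expectation f) with h | h
  · rw [abs_of_nonneg h] at hf
    exact sum_abs_fourierWalsh_le_of_expectation_nonneg h0 h1 hρ h hf
  · rw [abs_of_nonpos h] at hf
    have hneg : ∀ S, fourierWalsh (-f) S = -fourierWalsh f S := fun S => by
      have := expectation_const_mul (-1) fun x => f x * walsh S x
      simpa [fourierWalsh] using this
    have hE : expectation (-f) = -expectation f := by
      rw [← fourierWalsh_empty, hneg, fourierWalsh_empty]
    have := sum_abs_fourierWalsh_le_of_expectation_nonneg (f := -f) h0 h1 hρ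
      (by rw [hE]; linarith) (by rwa [hE, norm_neg])
    simpa [hneg] using this

end LowerBound

/-! ### Upper bound for the radius -/

section UpperBound

variable {N : ℕ}

/-- The sum of the coordinates. -/
noncomputable def coordSum (x : BooleanCube N) : ℝ := ∑ i, walsh {i} x

/-- The indicator function of the event that the sum of the coordinates is at least `s`. -/
noncomputable def upperTail (s : ℝ) (x : BooleanCube N) : ℝ :=
  open Classical in if s ≤ coordSum x then 1 else 0

lemma coordSum_neg (x : BooleanCube N) : coordSum (-x) = -coordSum x := by
  simp [coordSum, walsh_singleton_neg]

lemma expectation_coordSum : expectation (coordSum (N := N)) = 0 := by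
  have h := expectation_neg_arg (coordSum (N := N))
  have h2 := expectation_const_mul (-1) (coordSum (N := N))
  simp only [coordSum_neg, neg_one_mul] at h h2
  linarith

lemma upperTail_nonneg (s : ℝ) (x : BooleanCube N) : 0 ≤ upperTail s x := by
  unfold upperTail
  split_ifs <;> norm_num

lemma upperTail_le_one (s : ℝ) (x : BooleanCube N) : upperTail s x ≤ 1 := by
  unfold upperTail
  split_ifs <;> norm_num

lemma upperTail_add_upperTail_neg_le_one {s : ℝ} (hs : 0 < s) (x : BooleanCube N) :
    upperTail s x + upperTail s (-x) ≤ 1 := by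
  unfold upperTail
  rw [coordSum_neg]
  split_ifs <;> linarith

lemma expectation_upperTail_le_half {s : ℝ} (hs : 0 < s) :
    expectation (upperTail (N := N) s) ≤ 1 / 2 := by
  have h := expectation_mono (upperTail_add_upperTail_neg_le_one (N := N) hs)
  rw [expectation_add, expectation_neg_arg (upperTail s), expectation_const] at h
  linarith

lemma mul_expectation_upperTail_le (s : ℝ) :
    s * expectation (upperTail (N := N) s) ≤
      expectation fun x : BooleanCube N => upperTail s x * coordSum x := by
  rw [← expectation_const_mul]
  refine expectation_mono fun x => ?_
  unfold upperTail
  split_ifs with h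
  · simpa using h
  · simp

lemma expectation_exp_mul_coordSum (l : ℝ) :
    expectation (fun x : BooleanCube N => Real.exp (l * coordSum x)) = Real.cosh l ^ N := by
  have h : ∀ x : BooleanCube N, Real.exp (l * coordSum x) =
      ∏ i, Real.exp (l * ((x i : ℤ) : ℝ)) := by
    intro x
    rw [coordSum, Finset.mul_sum, Real.exp_sum]
    simp only [walsh_singleton]
  have h2 := Finset.prod_univ_sum (fun _ : Fin N => (Finset.univ : Finset ℤˣ))
    fun _ u => Real.exp (l * ((u : ℤ) : ℝ))
  rw [Fintype.piFinset_univ] at h2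
  simp only [expectation, h]
  rw [← h2, UnitsInt.univ, Finset.sum_pair (by decide)]
  simp only [Units.val_one, Int.cast_one, mul_one, Units.val_neg, Int.cast_neg, mul_neg,
    Finset.prod_const, Finset.card_univ, Fintype.card_fin, Real.cosh_eq, div_pow]
  ring

lemma exp_sq_div_three_le_cosh {l : ℝ} (h1 : l ^ 2 ≤ 1) : Real.exp (l ^ 2 / 3) ≤ Real.cosh l := by
  have hc : 1 + l ^ 2 / 2 ≤ Real.cosh l := by
    have h := sum_le_hasSum (Finset.range 2)
      (fun i _ => by rw [pow_mul]; positivity) (Real.hasSum_cosh l)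
    simpa [Finset.sum_range_succ] using h
  refine le_trans ?_ hc
  have hpos : 0 < 1 + l ^ 2 / 2 := by positivity
  rw [← Real.le_log_iff_exp_le hpos]
  refine le_trans ?_ (Real.one_sub_inv_le_log_of_pos hpos)
  rw [← sub_nonneg]
  -- The bound `log y ≥ 1 - 1/y` leaves `l²/(2 + l²) ≥ l²/3`, which is where `l² ≤ 1` enters.
  have : 1 - (1 + l ^ 2 / 2)⁻¹ - l ^ 2 / 3 = l ^ 2 * (1 - l ^ 2) / (6 * (1 + l ^ 2 / 2)) := by
    field_simp
    ring
  rw [this]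
  have : 0 ≤ 1 - l ^ 2 := by linarith
  positivity

/-- A lower bound for the upper tail of the binomial distribution. -/
theorem exp_le_expectation_upperTail {l : ℝ} (h0 : 0 ≤ l) (h1 : l ≤ 1) (hN : 6 ≤ N * l ^ 2) :
    Real.exp (-(2 * (N * l ^ 2))) / 4 ≤ expectation (upperTail (N := N) (N * l / 6)) := by
  set s := N * l / 6 with hs
  set c := Real.cosh l ^ N with hcdef
  have hl2 : l ^ 2 ≤ 1 := pow_le_one₀ h0 h1
  have hc1 : 1 ≤ c := one_le_pow₀ (Real.one_le_cosh l)
  -- A Paley-Zygmund argument for `exp (l X)`: `s` is chosen so that `exp (l s)` squared is `exp (N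
  -- l² / 3) ≤ c`. Hence the event `X < s` carries at most half of the mean, and Cauchy-Schwarz
  -- bounds the tail below.
  have hsc : 2 * Real.exp (l * s) ≤ c := by
    have h2 : 2 ≤ Real.exp (l * s) := by
      have : 1 ≤ l * s := by rw [hs]; linarith
      linarith [Real.add_one_le_exp (l * s)]
    calc 2 * Real.exp (l * s) ≤ Real.exp (l * s) * Real.exp (l * s) := by gcongr
      _ = Real.exp (l ^ 2 / 3) ^ N := by
          rw [← Real.exp_add, ← Real.exp_nat_mul, hs]
          ring_nf
      _ ≤ c := by
          rw [hcdef]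
          gcongr
          exact exp_sq_div_three_le_cosh hl2
  have hsplit : c ≤ Real.exp (l * s) +
      expectation fun x : BooleanCube N => Real.exp (l * coordSum x) * upperTail s x := by
    rw [hcdef, ← expectation_exp_mul_coordSum, ← expectation_const (N := N) (Real.exp (l * s)),
      ← expectation_add]
    refine expectation_mono fun x => ?_
    unfold upperTail
    split_ifs with h
    · rw [mul_one]
      linarith [Real.exp_pos (l * s)]
    · rw [mul_zero, add_zero]
      gcongr
      linarith
  have hcs := expectation_mul_sq_le (N := N) (fun x => Real.exp (l * coordSum x)) (upperTail s)
  have e1 : ∀ x : BooleanCube N, Real.exp (l * coordSum x) ^ 2 = Real.exp (2 * l * coordSum x) :=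
    fun x => by
      rw [← Real.exp_nat_mul]
      push_cast
      ring_nf
  have e2 : ∀ x : BooleanCube N, upperTail s x ^ 2 = upperTail s x := fun x => by
    unfold upperTail
    split_ifs <;> norm_num
  simp only [e1, e2, expectation_exp_mul_coordSum] at hcs
  have hμ : 0 ≤ expectation (upperTail (N := N) s) := expectation_nonneg (upperTail_nonneg s)
  change _ ≤ _ * expectation (upperTail s) at hcs
  have h2 : Real.cosh (2 * l) ^ N ≤ Real.exp (2 * (N * l ^ 2)) := by
    calc _ ≤ Real.exp ((2 * l) ^ 2 / 2) ^ N := by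
          gcongr
          exact Real.cosh_le_exp_half_sq _
      _ = _ := by rw [← Real.exp_nat_mul]; ring_nf
  have h3 : 1 / 4 ≤ Real.exp (2 * (N * l ^ 2)) * expectation (upperTail (N := N) s) := by
    have : (1 / 2 : ℝ) ≤
      expectation fun x : BooleanCube N => Real.exp (l * coordSum x) * upperTail s x := by linarith
    calc (1 / 4 : ℝ) = (1 / 2) ^ 2 := by norm_num
      _ ≤ _ := by gcongr
      _ ≤ _ := hcs.trans (by gcongr)
  rw [Real.exp_neg, div_le_iff₀ (by norm_num), inv_le_iff_one_le_mul₀ (Real.exp_pos _)]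
  linarith

lemma abs_expectation_add_mul_le {f : BooleanCube N → ℝ} {ρ : ℝ} (hρ : 0 ≤ ρ)
    (h : ∑ S : Finset (Fin N), |fourierWalsh f S| * ρ ^ S.card ≤ ‖f‖) :
    |expectation f| + ρ * (expectation fun x => f x * coordSum x) ≤ ‖f‖ := by
  rw [← Finset.add_sum_erase _ _ (Finset.mem_univ ∅), fourierWalsh_empty] at h
  simp only [Finset.card_empty, pow_zero, mul_one] at h
  refine le_trans (add_le_add_right ?_ _) h
  have e : (expectation fun x => f x * coordSum x) = ∑ i, fourierWalsh f {i} := by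
    simp only [coordSum, Finset.mul_sum]
    rw [expectation_sum]
    rfl
  have hsub : Finset.univ.image (fun i : Fin N => ({i} : Finset (Fin N))) ⊆
      (Finset.univ : Finset (Finset (Fin N))).erase ∅ := by
    intro S hS
    obtain ⟨i, -, rfl⟩ := Finset.mem_image.1 hS
    simp
  refine le_trans ?_ (Finset.sum_le_sum_of_subset_of_nonneg hsub fun _ _ _ => by positivity)
  rw [Finset.sum_image fun i _ j _ hij => Finset.singleton_injective hij, e, Finset.mul_sum]
  refine Finset.sum_le_sum fun i _ => ?_
  rw [Finset.card_singleton, pow_one, mul_comm]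
  gcongr
  exact le_abs_self _

lemma mul_le_one_of_half_le_expectation_upperTail {δ ρ s : ℝ} (hδ : 0 < δ) (hs : 0 < s)
    (hμ : δ / 2 ≤ expectation (upperTail (N := N) s)) (hρ : 0 ≤ ρ)
    (h : ∀ f ∈ biasedClass N δ, ∑ S : Finset (Fin N), |fourierWalsh f S| * ρ ^ S.card ≤ ‖f‖) :
    ρ * s ≤ 1 := by
  set μ := expectation (upperTail (N := N) s)
  have hμ2 : μ ≤ 1 / 2 := expectation_upperTail_le_half hs
  set f : BooleanCube N → ℝ := fun x => 2 * upperTail s x - 1 with hf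
  have habs : ∀ x, ‖f x‖ = 1 := fun x => by
    simp only [hf, upperTail]
    split_ifs <;> norm_num
  have hnorm : ‖f‖ = 1 := by
    refine le_antisymm ((pi_norm_le_iff_of_nonneg zero_le_one).2 fun x => (habs x).le) ?_
    rw [← habs 1]
    exact norm_le_pi_norm f 1
  have hE : expectation f = 2 * μ - 1 := by
    rw [hf, expectation_sub, expectation_const, expectation_const_mul]
  have hX : (expectation fun x => f x * coordSum x) =
      2 * expectation fun x : BooleanCube N => upperTail s x * coordSum x := by
    simp only [hf, sub_mul, one_mul, mul_assoc]
    rw [expectation_sub, expectation_const_mul]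
    have := expectation_coordSum (N := N)
    change _ - expectation coordSum = _
    rw [this, sub_zero]
  have hmem : f ∈ biasedClass N δ := by
    change |expectation f| ≤ (1 - δ) * ‖f‖
    rw [hE, hnorm, abs_of_nonpos (by linarith)]
    linarith
  have key := abs_expectation_add_mul_le hρ (h f hmem)
  rw [hE, hnorm, abs_of_nonpos (by linarith), hX] at key
  have hsμ := mul_expectation_upperTail_le (N := N) s
  have hμ0 : 0 < μ := by linarith
  have : ρ * s * μ ≤ 1 * μ := by
    have := mul_le_mul_of_nonneg_left hsμ hρ
    change ρ * (s * μ) ≤ _ at this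
    linarith
  exact le_of_mul_le_mul_right this hμ0

/-- The odd test function has mean zero, so it belongs to the class for every `δ ≤ 1` and no
relation between `δ` and the tail is needed. -/
lemma two_mul_expectation_upperTail_le_one {δ ρ s : ℝ} (hδ : δ ≤ 1) (hρ : 0 ≤ ρ)
    (h : ∀ f ∈ biasedClass N δ, ∑ S : Finset (Fin N), |fourierWalsh f S| * ρ ^ S.card ≤ ‖f‖) :
    ρ * (2 * (s * expectation (upperTail (N := N) s))) ≤ 1 := by
  set f : BooleanCube N → ℝ := fun x => upperTail s x - upperTail s (-x) with hf
  have hnorm : ‖f‖ ≤ 1 := (pi_norm_le_iff_of_nonneg zero_le_one).2 fun x => by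
    rw [Real.norm_eq_abs, abs_le]
    simp only [hf]
    constructor <;> linarith [upperTail_nonneg s x, upperTail_nonneg s (-x), upperTail_le_one s x,
      upperTail_le_one s (-x)]
  have hE : expectation f = 0 := by
    rw [hf, expectation_sub, expectation_neg_arg (upperTail s)]
    exact sub_self _
  have hX : (expectation fun x => f x * coordSum x) =
      2 * expectation fun x : BooleanCube N => upperTail s x * coordSum x := by
    simp only [hf, sub_mul]
    rw [expectation_sub, ← expectation_neg_arg fun x => upperTail s (-x) * coordSum x]
    have := expectation_const_mul (-1) fun x : BooleanCube N => upperTail s x * coordSum x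
    simp only [neg_neg, coordSum_neg, neg_one_mul, mul_neg] at this ⊢
    rw [this]
    ring
  have hmem : f ∈ biasedClass N δ := by
    change |expectation f| ≤ (1 - δ) * ‖f‖
    rw [hE, abs_zero]
    exact mul_nonneg (by linarith) (norm_nonneg f)
  have key := (abs_expectation_add_mul_le hρ (h f hmem)).trans hnorm
  rw [hE, abs_zero, zero_add, hX] at key
  refine le_trans ?_ key
  gcongr
  exact mul_expectation_upperTail_le s

lemma le_one_of_forall_biasedClass {δ ρ : ℝ} (hN : 1 ≤ N) (hδ : δ ≤ 1) (hρ : 0 ≤ ρ)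
    (h : ∀ f ∈ biasedClass N δ, ∑ S : Finset (Fin N), |fourierWalsh f S| * ρ ^ S.card ≤ ‖f‖) :
    ρ ≤ 1 := by
  set i : Fin N := ⟨0, hN⟩
  have hnorm : ‖walsh {i}‖ ≤ 1 := (pi_norm_le_iff_of_nonneg zero_le_one).2 fun x => by
    rw [Real.norm_eq_abs, ← sq_le_one_iff_abs_le_one, walsh_singleton_sq]
  have hmem : walsh {i} ∈ biasedClass N δ := by
    change |expectation (walsh {i})| ≤ (1 - δ) * ‖walsh {i}‖
    rw [expectation_walsh_of_nonempty (Finset.singleton_nonempty i), abs_zero]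
    exact mul_nonneg (by linarith) (norm_nonneg _)
  have hc : fourierWalsh (walsh {i}) {i} = 1 := by
    simp only [fourierWalsh, ← pow_two, walsh_singleton_sq, expectation_const]
  have := Finset.single_le_sum (f := fun S => |fourierWalsh (walsh {i}) S| * ρ ^ S.card)
    (fun S _ => by positivity) (Finset.mem_univ {i})
  simp only [hc, abs_one, Finset.card_singleton, pow_one, one_mul] at this
  exact this.trans ((h _ hmem).trans hnorm)

theorem le_div_of_forall_biasedClass {δ ρ : ℝ} (hN : 1 ≤ N) (hδN : 1 / 2 ^ N ≤ δ) (hδ : δ ≤ 1)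
    (hρ : 0 ≤ ρ)
    (h : ∀ f ∈ biasedClass N δ, ∑ S : Finset (Fin N), |fourierWalsh f S| * ρ ^ S.card ≤ ‖f‖) :
    ρ ≤ 24 * Real.exp 12 / (√N * √(Real.log (2 / δ))) := by
  have hδ0 : 0 < δ := lt_of_lt_of_le (by positivity) hδN
  have hL := half_le_log_two_div hδ0 hδ
  have hexpL : Real.exp (-Real.log (2 / δ)) = δ / 2 := by
    rw [Real.exp_neg, Real.exp_log (by positivity), inv_div]
  -- This is where `δ ≥ 2^(-N)` enters; it ensures `l ≤ 1` below.
  have hLN : Real.log (2 / δ) ≤ 2 * N := by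
    have h2 : 2 / δ ≤ 2 ^ (N + 1) := by
      rw [div_le_iff₀ hδ0, pow_succ]
      rw [div_le_iff₀ (by positivity)] at hδN
      linarith
    have := Real.log_le_log (by positivity) h2
    rw [Real.log_pow] at this
    push_cast at this
    have hN' : (1 : ℝ) ≤ N := by exact_mod_cast hN
    nlinarith [Real.log_two_lt_d9, Real.log_two_gt_d9]
  set L := Real.log (2 / δ)
  have hNpos : (0 : ℝ) < N := by exact_mod_cast hN
  have hE : (1 : ℝ) ≤ Real.exp 12 := Real.one_le_exp (by norm_num)
  rw [← Real.sqrt_mul hNpos.le, le_div_iff₀ (by positivity)]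
  rcases le_or_gt 24 L with hbig | hsmall
  -- With this `l` the tail is at least `exp (-L/2) / 4`, which exceeds `exp (-L) = δ/2` for large
  -- `L`, while `s = √(N L) / 12`.
  · set l := √(L / (4 * N)) with hl
    have hl2 : l ^ 2 = L / (4 * N) := Real.sq_sqrt (by positivity)
    have hNl : N * l ^ 2 = L / 4 := by rw [hl2]; field_simp
    have hl1 : l ≤ 1 := by
      rw [hl, Real.sqrt_le_one, div_le_one (by positivity)]
      linarith
    have hlpos : 0 < l := by positivity
    have ht := exp_le_expectation_upperTail (N := N) hlpos.le hl1 (by rw [hNl]; linarith)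
    have hs : √(N * L) = 12 * (N * l / 6) := by
      rw [Real.sqrt_eq_iff_eq_sq (by positivity) (by positivity),
        show (12 * (N * l / 6)) ^ 2 = 4 * N * (N * l ^ 2) by ring, hNl]
      ring
    have hμ : δ / 2 ≤ expectation (upperTail (N := N) (N * l / 6)) := by
      refine le_trans ?_ ht
      rw [← hexpL, hNl, le_div_iff₀ (by norm_num)]
      have h4 : 4 ≤ Real.exp (L / 2) := by linarith [Real.add_one_le_exp (L / 2)]
      calc Real.exp (-L) * 4 ≤ Real.exp (-L) * Real.exp (L / 2) := by gcongr
        _ = _ := by rw [← Real.exp_add]; ring_nf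
    have := mul_le_one_of_half_le_expectation_upperTail hδ0 (by positivity) hμ hρ h
    rw [hs]
    linarith
  rcases le_or_gt 6 N with h6 | h6
  · have h6' : (6 : ℝ) ≤ N := by exact_mod_cast h6
    -- The smallest `l` allowed by the tail bound: the tail is at least `exp (-12) / 4`, and `L <
    -- 24` gives `√(N L) ≤ 12 s`.
    set l := √(6 / N) with hl
    have hl2 : l ^ 2 = 6 / N := Real.sq_sqrt (by positivity)
    have hNl : N * l ^ 2 = 6 := by rw [hl2]; field_simp
    have hl1 : l ≤ 1 := by
      rw [hl, Real.sqrt_le_one, div_le_one (by positivity)]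
      exact h6'
    have hlpos : 0 < l := by positivity
    have ht := exp_le_expectation_upperTail (N := N) hlpos.le hl1 hNl.ge
    have hs : √(N * L) ≤ 12 * (N * l / 6) := by
      apply Real.sqrt_le_iff.2 ⟨by positivity, ?_⟩
      rw [show (12 * (N * l / 6)) ^ 2 = 4 * N * (N * l ^ 2) by ring, hNl]
      nlinarith
    have := two_mul_expectation_upperTail_le_one hδ (s := N * l / 6) hρ h
    rw [hNl, show -(2 * (6 : ℝ)) = -12 by norm_num, Real.exp_neg] at ht
    calc ρ * √(N * L) ≤ ρ * (12 * (N * l / 6)) := by gcongr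
      _ = 24 * Real.exp 12 * (ρ * (2 * (N * l / 6 * ((Real.exp 12)⁻¹ / 4)))) := by
          field_simp
          ring
      _ ≤ 24 * Real.exp 12 *
            (ρ * (2 * (N * l / 6 * expectation (upperTail (N := N) (N * l / 6))))) := by
          gcongr
      _ ≤ 24 * Real.exp 12 * 1 := by gcongr
      _ = _ := mul_one _
  · have h6' : (N : ℝ) ≤ 6 := by exact_mod_cast h6.le
    have h1 := le_one_of_forall_biasedClass hN hδ hρ h
    have hs : √(N * L) ≤ 12 := by
      apply Real.sqrt_le_iff.2 ⟨by positivity, ?_⟩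
      nlinarith
    calc ρ * √(N * L) ≤ 1 * 12 := by gcongr
      _ ≤ _ := by linarith

end UpperBound

/-! ### The two bounds combined -/

theorem mainTheorem8 :
    ∃ C : ℝ, 0 < C ∧ ∀ N : ℕ, 1 ≤ N → ∀ δ : ℝ, 1 / 2 ^ N ≤ δ → δ ≤ 1 →
      C⁻¹ / (Real.sqrt (N : ℝ) * Real.sqrt (Real.log (2 / δ))) ≤
          booleanRadius (biasedClass N δ) ∧
        booleanRadius (biasedClass N δ) ≤
          C / (Real.sqrt (N : ℝ) * Real.sqrt (Real.log (2 / δ))) := by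
  refine ⟨24 * Real.exp 12, by positivity, fun N hN δ hδN hδ => ⟨?_, ?_⟩⟩
  · have hδ0 : 0 < δ := lt_of_lt_of_le (by positivity) hδN
    have hL := half_le_log_two_div hδ0 hδ
    have hNpos : (0 : ℝ) < N := by exact_mod_cast hN
    -- The upper bound also supplies the boundedness without which the supremum would take a default
    -- value.
    refine le_csSup ⟨_, fun ρ hρ => le_div_of_forall_biasedClass hN hδN hδ hρ.1 hρ.2⟩
      ⟨by positivity, fun f hf => sum_abs_fourierWalsh_le_norm hδ0 hδ ?_ hf⟩
    have hE : (1 : ℝ) ≤ Real.exp 12 := Real.one_le_exp (by norm_num)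
    rw [div_pow, mul_pow, Real.sq_sqrt hNpos.le, Real.sq_sqrt (by linarith), inv_pow,
      show 16 * (((24 * Real.exp 12) ^ 2)⁻¹ / (N * Real.log (2 / δ)) * N * Real.log (2 / δ)) =
        16 / (24 * Real.exp 12) ^ 2 by field_simp, div_le_one (by positivity)]
    nlinarith
  · exact Real.sSup_le (fun ρ hρ => le_div_of_forall_biasedClass hN hδN hδ hρ.1 hρ.2)
      (by positivity)
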